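/- Let $\mathbb D$ be the open unit disk. Fix $q\in\mathbb C$ with $\Re q>0$ and $r>0$. Let $\mathcal J_r$ be the class of nonlinear resolvents $G_r=F^{-1}:\mathbb D\to\mathbb D$, that is, of maps $G_r:\mathbb D\to\mathbb D$ with $F(G_r(w))=w$ for all $w\in\mathbb D$, where $F$ is a holomorphic function on $\mathbb D$ with $F(0)=0$, $F'(0)=1+rq$ and $$\Re\left[\frac1{2r\Re q}\left(\frac{F(z)}z-(1+rq)\right)\right]>-\frac12,\qquad z\in\mathbb D\setminus\{0\}$$ (equivalently, $\Re\frac{F(z)}{z}>1$; thus $F=\mathrm{Id}+rf$, where $f(z)=zp(z)$ with $p$ holomorphic, $\Re p>0$ and $p(0)=q$). For real $x$ let $$A(x)=\frac{6x(1+x)}{(1+x)^3-3(5x-1)},$$ and let $r_0\approx 5.924$ be the largest real root of the equation $A(x)=1$. If $r\Re q>r_0$ and $G_r\in\mathcal J_r$, then $G_r$ is holomorphic in $\mathbb D$, $G_r(0)=0$, $G_r'(0)\ne0$, $G_r(w)\neq0$ for $w\in\mathbb D\setminus\{0\}$, $0<A(r\Re q)<1$, and for all $w\in\mathbb D$ $$\left|\frac{wG_r'(w)}{G_r(w)}-\frac1{1-A^2(r\Re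 q)}\right|\le\frac{A(r\Re q)}{1-A^2(r\Re q)},$$ where at $w=0$ the quotient $wG_r'(w)/G_r(w)$ is understood as its limit $1$. -/

import Mathlib

open Set Metric

noncomputable section

namespace NonlinearResolvent

/-- The open unit disk. -/
abbrev disk : Set ℂ := ball (0 : ℂ) 1

/-- The class of functions `F`, holomorphic in the unit disk, with `F 0 = 0`, `F' 0 = β` and
`Re ((F z / z - β) / α) > -1/2` in the disk. At `z = 0` the quotient `F z / z` is understood as its
limit `F' 0 = β`, for which the inequality is trivially true; so only `z ≠ 0` is listed. -/
def classA (α β : ℂ) : Set (ℂ → ℂ) :=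
  {F | DifferentiableOn ℂ F disk ∧ F 0 = 0 ∧ deriv F 0 = β ∧
    ∀ z ∈ disk, z ≠ 0 → -(1 / 2 : ℝ) < (1 / α * (F z / z - β)).re}

/-- The class of resolvents with parameter `r` (for generators with `f 0 = 0`, `f' 0 = q`): the
inverses `G : disk → disk` of the functions `F = id + r f` in the class with `α = 2 r Re q` and
`β = 1 + r q`. Only the values of `G` on the disk matter. Nothing but the inverse relation
`F (G w) = w` is required of `G`; in particular holomorphy and injectivity are not assumed. -/
def resolventClass (q : ℂ) (r : ℝ) : Set (ℂ → ℂ) :=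
  {G | ∃ F ∈ classA ((2 * r * q.re : ℝ) : ℂ) (1 + r * q), MapsTo G disk disk ∧ RightInvOn G F disk}

/-- The function `A`. -/
def A (x : ℝ) : ℝ := 6 * x * (1 + x) / ((1 + x) ^ 3 - 3 * (5 * x - 1))

/-- The largest real root of the equation `A x = 1`; see `isGreatest_r₀`. -/
def r₀ : ℝ := sSup {x : ℝ | A x = 1}

/-- The function `w * G' w / G w` for `G` with `G 0 = 0`, written as `G' w / (G w / w)`, where
`G w / w` is continued by `G' 0` to `w = 0`. -/
def starRatio (G : ℂ → ℂ) (w : ℂ) : ℂ := deriv G w / dslope G 0 w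

theorem starRatio_of_ne {G : ℂ → ℂ} (h0 : G 0 = 0) {w : ℂ} (hw : w ≠ 0) :
    starRatio G w = w * deriv G w / G w := by
  rw [starRatio, dslope_of_ne _ hw, slope_def_field, h0, sub_zero, sub_zero, div_div_eq_mul_div,
    mul_comm]

theorem starRatio_zero {G : ℂ → ℂ} (h : deriv G 0 ≠ 0) : starRatio G 0 = 1 := by
  rw [starRatio, dslope_same, div_self h]

theorem A_eq_one_iff (x : ℝ) : A x = 1 ↔ x ^ 3 - 3 * x ^ 2 - 18 * x + 4 = 0 := by
  unfold A
  by_cases hd : (1 + x) ^ 3 - 3 * (5 * x - 1) = 0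
  · have hf : (x - 2) * (x ^ 2 + 5 * x - 2) = 0 := by linear_combination hd
    rw [hd, div_zero]
    refine ⟨fun h => absurd h (by norm_num), fun h => ?_⟩
    rcases mul_eq_zero.mp hf with h2 | h2
    · have : x = 2 := by linarith
      subst this; norm_num at h
    · exfalso
      have h3 : 24 * x = 12 := by linear_combination h - (x - 8) * h2
      have : x = 1 / 2 := by linarith
      subst this; norm_num at h2
  · rw [div_eq_one_iff_eq hd]
    constructor <;> intro h <;> linear_combination -h

theorem exists_isGreatest :
    ∃ x : ℝ, IsGreatest {x : ℝ | A x = 1} x ∧ 5.9243 < x ∧ x < 5.9244 := by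
  have hc : ContinuousOn (fun x : ℝ => x ^ 3 - 3 * x ^ 2 - 18 * x + 4) (Icc 5.9243 5.9244) := by
    fun_prop
  obtain ⟨x, hx, h⟩ := intermediate_value_Ioo (by norm_num) hc
    (show (0 : ℝ) ∈ Ioo _ _ by constructor <;> norm_num)
  simp only at h
  refine ⟨x, ⟨(A_eq_one_iff x).2 h, fun y hy => ?_⟩, hx.1, hx.2⟩
  have hy' := (A_eq_one_iff y).1 hy
  by_contra! hlt
  have h1 := hx.1
  have hp : (y - x) * (y ^ 2 + x * y + x ^ 2 - 3 * (x + y) - 18) = 0 := by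
    linear_combination hy' - h
  rcases mul_eq_zero.mp hp with h2 | h2
  · linarith
  · nlinarith [mul_pos (sub_pos.2 h1) (sub_pos.2 (h1.trans hlt))]

/-- The equation `A x = 1` has a largest real root, it is `r₀`, and `r₀ ≈ 5.9243`. -/
theorem isGreatest_r₀ :
    IsGreatest {x : ℝ | A x = 1} r₀ ∧ 5.9243 < r₀ ∧ r₀ < 5.9244 := by
  obtain ⟨x, hx, h1, h2⟩ := exists_isGreatest
  have : r₀ = x := hx.csSup_eq
  rw [this]
  exact ⟨hx, h1, h2⟩

end NonlinearResolvent

end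

/-!
Write `F z = z * h z`, where `h` is holomorphic in the disk with `Re h > 1` and
`Re (h 0) = 1 + x`, `x = r Re q`. For `z = G w` one has `w = F z`, hence
`w G' w / G w = F z / (z F' z) = 1 / (1 + u)` with `u = z h' z / h z`. The image of the disk
`‖u‖ ≤ a < 1` under `u ↦ 1 / (1 + u)` is the disk with centre `1 / (1 - a²)` and radius
`a / (1 - a²)` (`norm_one_div_one_add_sub_le`), so everything reduces to `‖u‖ ≤ A x`.

Two consequences of the Schwarz lemma for functions with positive real part give this bound.
Harnack's inequality bounds `Re (h z)` from below near the origin, and with `‖z * h z‖ = ‖w‖ < 1`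
this forces `‖z‖ < 1 / (x - 1)`: the image of `G` is a small disk (`norm_mul_lt_one`). The
derivative estimate gives `‖h' z‖ ≤ 2 (Re (h z) - 1) / (1 - ‖z‖)`. Together they yield
`‖u‖ ≤ 2 / (x - 2)` (`norm_mul_deriv_div_le`), and `2 / (x - 2) ≤ A x < 1` for `x > r₀`
(`two_div_le_A`, `A_lt_one`).

In particular `F'` does not vanish on the image of `G`. Moreover `F z = w` is the fixed point
equation `z = w / h z`, whose right-hand side contracts the disk of radius `1 / 4`; so the solution
is unique (`eq_of_mul_eq_mul`), `G` agrees with the local inverses of `F`, and is holomorphic.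
-/

namespace NonlinearResolvent

open Complex ComplexConjugate Filter Topology

/-! ### Holomorphic functions with positive real part -/

section PositiveRealPart

variable {p : ℂ → ℂ} {c : ℂ} {R : ℝ}

theorem norm_sub_lt_norm_add_conj {a b : ℂ} (ha : 0 < a.re) (hb : 0 < b.re) :
    ‖a - b‖ < ‖a + conj b‖ := by
  rw [← sq_lt_sq₀ (norm_nonneg _) (norm_nonneg _), ← normSq_eq_norm_sq, ← normSq_eq_norm_sq,
    normSq_apply, normSq_apply]
  simp only [sub_re, sub_im, add_re, add_im, conj_re, conj_im]
  nlinarith [mul_pos ha hb]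

theorem add_conj_ne_zero {a b : ℂ} (ha : 0 < a.re) (hb : 0 < b.re) : a + conj b ≠ 0 :=
  norm_pos_iff.1 ((norm_nonneg _).trans_lt (norm_sub_lt_norm_add_conj ha hb))

theorem differentiableOn_cayley (hp : DifferentiableOn ℂ p (ball c R)) (hR : 0 < R)
    (hre : ∀ z ∈ ball c R, 0 < (p z).re) :
    DifferentiableOn ℂ (fun z => (p z - p c) / (p z + conj (p c))) (ball c R) :=
  (hp.sub_const _).div (hp.add_const _) fun z hz =>
    add_conj_ne_zero (hre z hz) (hre c (mem_ball_self hR))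

theorem mapsTo_cayley (hR : 0 < R) (hre : ∀ z ∈ ball c R, 0 < (p z).re) :
    MapsTo (fun z => (p z - p c) / (p z + conj (p c))) (ball c R)
      (closedBall ((fun z => (p z - p c) / (p z + conj (p c))) c) 1) := by
  intro z hz
  simp only [sub_self, zero_div, mem_closedBall_zero_iff, norm_div]
  exact div_le_one_of_le₀ (norm_sub_lt_norm_add_conj (hre z hz) (hre c (mem_ball_self hR))).le
    (norm_nonneg _)

/-- The Schwarz lemma for the derivative, transported from the disk to the right half-plane. -/
theorem norm_deriv_le_of_re_pos (hp : DifferentiableOn ℂ p (ball c R)) (hR : 0 < R)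
    (hre : ∀ z ∈ ball c R, 0 < (p z).re) : ‖deriv p c‖ ≤ 2 * (p c).re / R := by
  have hc := mem_ball_self (x := c) hR
  have hpc := hre c hc
  have hd := (hp.differentiableAt (isOpen_ball.mem_nhds hc)).hasDerivAt
  have hne := add_conj_ne_zero hpc hpc
  have hk := ((hd.sub_const (p c)).div (hd.add_const (conj (p c))) hne).deriv
  have hle := norm_deriv_le_div_of_mapsTo_ball (differentiableOn_cayley hp hR hre)
    (mapsTo_cayley hR hre) hR
  have hval : deriv (fun z => (p z - p c) / (p z + conj (p c))) c
      = deriv p c / (p c + conj (p c)) := by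
    refine hk.trans ?_
    field_simp
    ring
  rw [hval, norm_div, add_conj, norm_real, Real.norm_of_nonneg (by positivity),
    div_le_iff₀ (by positivity)] at hle
  exact hle.trans_eq (by ring)

/-- Harnack's inequality for the real part of a holomorphic function. -/
theorem harnack_of_re_pos (hp : DifferentiableOn ℂ p (ball c R)) (hR : 0 < R)
    (hre : ∀ z ∈ ball c R, 0 < (p z).re) {z : ℂ} (hz : z ∈ ball c R) :
    (R - dist z c) * (p c).re ≤ (R + dist z c) * (p z).re := by
  have hpc := hre c (mem_ball_self hR)
  have hpz := hre z hz
  have hle := dist_le_div_mul_dist_of_mapsTo_ball (differentiableOn_cayley hp hR hre)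
    (mapsTo_cayley hR hre) hz
  have hpos : 0 < ‖p z + conj (p c)‖ := norm_pos_iff.2 (add_conj_ne_zero hpz hpc)
  have hzR : dist z c < R := mem_ball.1 hz
  rw [sub_self, zero_div, dist_zero_right, norm_div, div_le_iff₀ hpos] at hle
  have hle' : R * ‖p z - p c‖ ≤ dist z c * ‖p z + conj (p c)‖ := by
    calc R * ‖p z - p c‖ ≤ R * (1 / R * dist z c * ‖p z + conj (p c)‖) := by gcongr
      _ = _ := by field_simp
  have hsq := pow_le_pow_left₀ (by positivity) hle' 2
  rw [mul_pow, mul_pow, ← normSq_eq_norm_sq, ← normSq_eq_norm_sq, normSq_apply,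
    normSq_apply] at hsq
  simp only [sub_re, sub_im, add_re, add_im, conj_re, conj_im] at hsq
  have hRd : dist z c ^ 2 ≤ R ^ 2 := pow_le_pow_left₀ dist_nonneg hzR.le 2
  -- The imaginary parts enter both sides by the same square, so they can be dropped.
  have hre2 : (R * ((p c).re - (p z).re)) ^ 2 ≤ (dist z c * ((p z).re + (p c).re)) ^ 2 := by
    nlinarith [mul_nonneg (sub_nonneg.2 hRd) (sq_nonneg ((p z).im - (p c).im))]
  have := abs_le_of_sq_le_sq' hre2 (mul_nonneg dist_nonneg (by positivity))
  linarith [this.2]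

end PositiveRealPart

/-! ### The equation `z * h z = w` for `Re h > 1` -/

section Equation

variable {h : ℂ → ℂ}

theorem norm_deriv_le_of_one_lt_re (hh : DifferentiableOn ℂ h disk)
    (hre : ∀ z ∈ disk, 1 < (h z).re) {z : ℂ} (hz : ‖z‖ < 1) :
    ‖deriv h z‖ ≤ 2 * ((h z).re - 1) / (1 - ‖z‖) := by
  have hsub : ball z (1 - ‖z‖) ⊆ disk := ball_subset_ball' (by simp)
  have := norm_deriv_le_of_re_pos (p := fun ζ => h ζ - 1) ((hh.mono hsub).sub_const 1)
    (sub_pos.2 hz) fun ζ hζ => by simpa using hre ζ (hsub hζ)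
  simpa using this

/-- Where `‖z * h z‖ < 1`, Harnack's inequality forces `z` into a disk of radius
`1 / ((h 0).re - 2)`. -/
theorem norm_mul_lt_one (hh : DifferentiableOn ℂ h disk) (hre : ∀ z ∈ disk, 1 < (h z).re)
    {z : ℂ} (hz : ‖z‖ < 1) (hw : ‖z * h z‖ < 1) : ‖z‖ * ((h 0).re - 2) < 1 := by
  have hH := harnack_of_re_pos (p := fun ζ => h ζ - 1) (hh.sub_const 1) one_pos
    (fun ζ hζ => by simpa using hre ζ hζ) (mem_ball_zero_iff.2 hz)
  simp only [dist_zero_right, sub_re, one_re] at hH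
  rw [norm_mul] at hw
  have hn := norm_nonneg z
  have h1 : ‖z‖ * (h z).re < 1 :=
    (mul_le_mul_of_nonneg_left (re_le_norm _) hn).trans_lt hw
  have h2 := mul_le_mul_of_nonneg_left hH hn
  have h3 : (1 + ‖z‖) * (‖z‖ * (h z).re) < 1 + ‖z‖ := by nlinarith
  -- The combined inequality factors as `(1 - ‖z‖) * (1 - ‖z‖ * ((h 0).re - 2)) > 0`.
  have h4 : 0 < (1 - ‖z‖) * (1 - ‖z‖ * ((h 0).re - 2)) := by nlinarith
  linarith [pos_of_mul_pos_right h4 (sub_nonneg.2 hz.le)]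

theorem norm_mul_deriv_div_le (hh : DifferentiableOn ℂ h disk)
    (hre : ∀ z ∈ disk, 1 < (h z).re) (h0 : 3 < (h 0).re) {z : ℂ} (hz : ‖z‖ < 1)
    (hw : ‖z * h z‖ < 1) : ‖z * deriv h z / h z‖ ≤ 2 / ((h 0).re - 3) := by
  have hzre := hre z (mem_ball_zero_iff.2 hz)
  have hd := norm_deriv_le_of_one_lt_re hh hre hz
  have hs := norm_mul_lt_one hh hre hz hw
  have hle : (h z).re - 1 ≤ ‖h z‖ := by linarith [re_le_norm (h z)]
  have hpos : 0 < ‖h z‖ := by linarith [re_le_norm (h z)]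
  have hz' : 0 < 1 - ‖z‖ := sub_pos.2 hz
  rw [norm_div, norm_mul, div_le_iff₀ hpos]
  calc ‖z‖ * ‖deriv h z‖ ≤ ‖z‖ * (2 * ‖h z‖ / (1 - ‖z‖)) := by gcongr; exact hd.trans (by gcongr)
    _ = 2 * ‖z‖ / (1 - ‖z‖) * ‖h z‖ := by ring
    _ ≤ 2 / ((h 0).re - 3) * ‖h z‖ := by
      refine mul_le_mul_of_nonneg_right ?_ hpos.le
      rw [div_le_div_iff₀ hz' (by linarith)]
      linarith

/-- The map `z ↦ w / h z` contracts the disk of radius `1 / 4`, so `z * h z = w` has at most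
one solution there; by `norm_mul_lt_one` there are no others. -/
theorem eq_of_mul_eq_mul (hh : DifferentiableOn ℂ h disk) (hre : ∀ z ∈ disk, 1 < (h z).re)
    (h0 : 6 < (h 0).re) {z₁ z₂ : ℂ} (hz₁ : ‖z₁‖ < 1) (hz₂ : ‖z₂‖ < 1) (hw : ‖z₁ * h z₁‖ < 1)
    (heq : z₁ * h z₁ = z₂ * h z₂) : z₁ = z₂ := by
  have hne : ∀ z ∈ disk, h z ≠ 0 := fun z hz hz0 => by
    have := hre z hz
    rw [hz0, zero_re] at this
    linarith
  have hsub : ball (0 : ℂ) (1 / 4) ⊆ disk := ball_subset_ball (by norm_num)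
  have hsmall : ∀ z : ℂ, ‖z‖ < 1 → ‖z * h z‖ < 1 → z ∈ ball (0 : ℂ) (1 / 4) := fun z hz hzw => by
    have := norm_mul_lt_one hh hre hz hzw
    rw [mem_ball_zero_iff]
    nlinarith [norm_nonneg z]
  have hderiv : ∀ z ∈ disk,
      HasDerivAt (fun ζ => z₁ * h z₁ / h ζ) (-(z₁ * h z₁ * deriv h z) / h z ^ 2) z := by
    intro z hz
    have := (hasDerivAt_const z (z₁ * h z₁)).div
      (hh.differentiableAt (isOpen_ball.mem_nhds hz)).hasDerivAt (hne z hz)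
    exact this.congr_deriv (by simp)
  have hlip := (convex_ball (0 : ℂ) (1 / 4)).norm_image_sub_le_of_norm_hasDerivWithin_le
    (f := fun ζ => z₁ * h z₁ / h ζ) (C := 2 / 3)
    (fun z hz => (hderiv z (hsub hz)).hasDerivWithinAt) (fun z hz => ?_)
    (hsmall z₁ hz₁ hw) (hsmall z₂ hz₂ (heq ▸ hw))
  · have e₁ : z₁ * h z₁ / h z₁ = z₁ := mul_div_cancel_right₀ _ (hne z₁ (mem_ball_zero_iff.2 hz₁))
    have e₂ : z₁ * h z₁ / h z₂ = z₂ := by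
      rw [heq, mul_div_cancel_right₀ _ (hne z₂ (mem_ball_zero_iff.2 hz₂))]
    simp only [e₁, e₂] at hlip
    have : ‖z₂ - z₁‖ = 0 := by linarith [norm_nonneg (z₂ - z₁)]
    exact (sub_eq_zero.1 (norm_eq_zero.1 this)).symm
  · have hz4 : ‖z‖ < 1 / 4 := mem_ball_zero_iff.1 hz
    have hd := norm_deriv_le_of_one_lt_re hh hre (hz4.trans (by norm_num))
    have hzre := hre z (hsub hz)
    have hn := re_le_norm (h z)
    have hpos : 0 < ‖h z‖ := by linarith
    rw [norm_div, norm_neg, norm_mul, norm_pow, div_le_iff₀ (by positivity)]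
    calc ‖z₁ * h z₁‖ * ‖deriv h z‖ ≤ 1 * ‖deriv h z‖ := by gcongr
      _ ≤ 2 * ((h z).re - 1) / (1 - ‖z‖) := by rwa [one_mul]
      _ ≤ 2 * (‖h z‖ - 1) / (1 - 1 / 4) := by
        gcongr
        linarith
      -- `t - 1 ≤ t ^ 2 / 4` for `t = ‖h z‖`
      _ ≤ 2 / 3 * ‖h z‖ ^ 2 := by
        rw [div_le_iff₀ (by norm_num)]
        linarith [sq_nonneg (‖h z‖ - 2)]

end Equation

/-! ### The function `A` and the target disk -/

theorem A_pos {x : ℝ} (hx : 2 < x) : 0 < A x := by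
  have : (1 + x) ^ 3 - 3 * (5 * x - 1) = (x - 2) * (x ^ 2 + 5 * x - 2) := by ring
  rw [A, this]
  have h2 : 0 < x - 2 := by linarith
  have h3 : 0 < x ^ 2 + 5 * x - 2 := by nlinarith
  positivity

theorem two_div_le_A {x : ℝ} (hx : 2 < x) : 2 / (x - 2) ≤ A x := by
  have : (1 + x) ^ 3 - 3 * (5 * x - 1) = (x - 2) * (x ^ 2 + 5 * x - 2) := by ring
  rw [A, this]
  have h2 : 0 < x - 2 := by linarith
  have h3 : 0 < x ^ 2 + 5 * x - 2 := by nlinarith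
  rw [div_le_div_iff₀ h2 (by positivity)]
  have h4 : 2 * (x ^ 2 + 5 * x - 2) ≤ 6 * x * (1 + x) := by nlinarith [sq_nonneg (2 * x - 1)]
  calc 2 * ((x - 2) * (x ^ 2 + 5 * x - 2)) = 2 * (x ^ 2 + 5 * x - 2) * (x - 2) := by ring
    _ ≤ _ := by gcongr

theorem A_lt_one {x : ℝ} (hx : r₀ < x) : A x < 1 := by
  obtain ⟨⟨hr, -⟩, hlo, -⟩ := isGreatest_r₀
  have hroot := (A_eq_one_iff r₀).1 hr
  have hden : 0 < (1 + x) ^ 3 - 3 * (5 * x - 1) := by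
    have h2 : 0 < x - 2 := by linarith
    have h3 : 0 < x ^ 2 + 5 * x - 2 := by nlinarith
    nlinarith [mul_pos h2 h3]
  rw [A, div_lt_one hden]
  -- `A x < 1` says that the cubic of `A_eq_one_iff` is positive at `x`; divide out its root `r₀`.
  have hquad : 0 < x ^ 2 + x * r₀ + r₀ ^ 2 - 3 * (x + r₀) - 18 := by nlinarith
  nlinarith [mul_pos (sub_pos.2 hx) hquad]

theorem norm_one_div_one_add_sub_le {u : ℂ} {a : ℝ} (hu : ‖u‖ ≤ a) (ha : a < 1) :
    ‖1 / (1 + u) - ((1 / (1 - a ^ 2) : ℝ) : ℂ)‖ ≤ a / (1 - a ^ 2) := by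
  have ha0 : 0 ≤ a := (norm_nonneg u).trans hu
  have hd : 0 < 1 - a ^ 2 := by nlinarith
  have hne : 1 + u ≠ 0 := fun h => by
    rw [← neg_eq_iff_add_eq_zero] at h
    rw [← h, norm_neg, norm_one] at hu
    linarith
  have hdC : ((1 - a ^ 2 : ℝ) : ℂ) ≠ 0 := ofReal_ne_zero.2 hd.ne'
  have key : ‖(a : ℂ) ^ 2 + u‖ ≤ a * ‖1 + u‖ := by
    have hu2 : u.re * u.re + u.im * u.im ≤ a ^ 2 := by
      rw [← normSq_apply, normSq_eq_norm_sq]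
      gcongr
    rw [← sq_le_sq₀ (norm_nonneg _) (by positivity), mul_pow, ← normSq_eq_norm_sq,
      ← normSq_eq_norm_sq, normSq_apply, normSq_apply, ← ofReal_pow]
    simp only [add_re, add_im, ofReal_re, ofReal_im, one_re, one_im]
    nlinarith [mul_nonneg hd.le (sub_nonneg.2 hu2)]
  have e : 1 / (1 + u) - ((1 / (1 - a ^ 2) : ℝ) : ℂ)
      = -((a : ℂ) ^ 2 + u) / ((1 + u) * ((1 - a ^ 2 : ℝ) : ℂ)) := by
    rw [ofReal_div, ofReal_one, div_sub_div _ _ hne hdC]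
    push_cast
    ring
  rw [e, norm_div, norm_neg, norm_mul, norm_real, Real.norm_of_nonneg hd.le,
    div_le_div_iff₀ (mul_pos (norm_pos_iff.2 hne) hd) hd]
  calc ‖(a : ℂ) ^ 2 + u‖ * (1 - a ^ 2) ≤ a * ‖1 + u‖ * (1 - a ^ 2) := by gcongr
    _ = _ := by ring

/-! ### Resolvents -/

theorem mul_dslope_zero {F : ℂ → ℂ} (h0 : F 0 = 0) (z : ℂ) : z * dslope F 0 z = F z := by
  simpa [h0] using sub_smul_dslope F 0 z

theorem re_dslope_zero {q : ℂ} {r : ℝ} {F : ℂ → ℂ}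
    (hF : F ∈ classA ((2 * r * q.re : ℝ) : ℂ) (1 + r * q)) :
    (dslope F 0 0).re = 1 + r * q.re := by
  rw [dslope_same, hF.2.2.1]
  simp

theorem one_lt_re_dslope {q : ℂ} {r : ℝ} {F : ℂ → ℂ} (hrq : 0 < r * q.re)
    (hF : F ∈ classA ((2 * r * q.re : ℝ) : ℂ) (1 + r * q)) {z : ℂ} (hz : z ∈ disk) :
    1 < (dslope F 0 z).re := by
  rcases eq_or_ne z 0 with rfl | hz0
  · rw [re_dslope_zero hF]
    linarith
  · have h := hF.2.2.2 z hz hz0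
    rw [← mul_dslope_zero hF.2.1 z, mul_div_cancel_left₀ _ hz0, ← ofReal_one, ← ofReal_div,
      re_ofReal_mul, one_div_mul_eq_div, lt_div_iff₀ (by linarith)] at h
    simp only [sub_re, add_re, ofReal_re, re_ofReal_mul] at h
    linarith

/-- A right inverse `G` of `F` is differentiable at `w` if `F' (G w) ≠ 0` and the solution of
`F z = w` is unique: it coincides near `w` with the local inverse of `F`. -/
theorem hasDerivAt_rightInvOn {F G : ℂ → ℂ} {s t : Set ℂ} (hs : IsOpen s) (ht : IsOpen t)
    (hF : DifferentiableOn ℂ F s) (hG : MapsTo G t s) (hFG : RightInvOn G F t)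
    (huniq : ∀ z₁ ∈ s, ∀ z₂ ∈ s, F z₁ ∈ t → F z₁ = F z₂ → z₁ = z₂) {w : ℂ} (hw : w ∈ t)
    (hne : deriv F (G w) ≠ 0) : HasDerivAt G (deriv F (G w))⁻¹ w := by
  have hst : HasStrictDerivAt F (deriv F (G w)) (G w) :=
    (hF.analyticAt (hs.mem_nhds (hG hw))).hasStrictDerivAt
  have hloc := (hst.to_localInverse hne).hasDerivAt
  have hval : hst.localInverse F _ _ hne (F (G w)) = G w :=
    HasStrictFDerivAt.localInverse_apply_image (hst.hasStrictFDerivAt_equiv hne)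
  have hright := hst.eventually_right_inverse hne
  have hmem : ∀ᶠ y in 𝓝 (F (G w)), hst.localInverse F _ _ hne y ∈ s :=
    hloc.continuousAt.eventually (by rw [hval]; exact hs.mem_nhds (hG hw))
  rw [hFG hw] at hloc hright hmem
  refine hloc.congr_of_eventuallyEq ?_
  filter_upwards [hright, hmem, ht.mem_nhds hw] with y hy hys hyt
  exact huniq _ (hG hyt) _ hys ((hFG hyt).symm ▸ hyt) ((hFG hyt).trans hy.symm)

end NonlinearResolvent

open NonlinearResolvent in
theorem mainTheorem1 (q : ℂ) (hq : 0 < q.re) (r : ℝ) (hr : 0 < r)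
    (hrq : NonlinearResolvent.r₀ < r * q.re)
    (G : ℂ → ℂ) (hG : G ∈ NonlinearResolvent.resolventClass q r) :
    DifferentiableOn ℂ G NonlinearResolvent.disk ∧ G 0 = 0 ∧ deriv G 0 ≠ 0 ∧
    (∀ w ∈ NonlinearResolvent.disk, w ≠ 0 → G w ≠ 0) ∧
    (0 < NonlinearResolvent.A (r * q.re) ∧ NonlinearResolvent.A (r * q.re) < 1) ∧
    ∀ w ∈ NonlinearResolvent.disk,
      ‖NonlinearResolvent.starRatio G w
          - ((1 / (1 - NonlinearResolvent.A (r * q.re) ^ 2) : ℝ) : ℂ)‖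
        ≤ NonlinearResolvent.A (r * q.re) / (1 - NonlinearResolvent.A (r * q.re) ^ 2) := by
  obtain ⟨F, hF, hmaps, hinv⟩ := hG
  have hx : 5.9 < r * q.re := by linarith [isGreatest_r₀.2.1]
  have hA1 := A_lt_one hrq
  have hA0 : 0 < A (r * q.re) := A_pos (by linarith)
  have hF0 : F 0 = 0 := hF.2.1
  set h := dslope F 0
  have hh : DifferentiableOn ℂ h disk :=
    (Complex.differentiableOn_dslope (ball_mem_nhds 0 one_pos)).2 hF.1
  have hre : ∀ z ∈ disk, 1 < (h z).re := fun z hz => one_lt_re_dslope (by linarith) hF hz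
  have h0 : (h 0).re = 1 + r * q.re := re_dslope_zero hF
  have hne : ∀ z ∈ disk, h z ≠ 0 := fun z hz hz0 => by
    have := hre z hz
    rw [hz0, Complex.zero_re] at this
    linarith
  have hmul : ∀ z, z * h z = F z := mul_dslope_zero hF0
  have hFderiv : ∀ z ∈ disk, deriv F z = h z * (1 + z * deriv h z / h z) := fun z hz => by
    have hd := (hasDerivAt_id' z).mul (hh.differentiableAt (isOpen_ball.mem_nhds hz)).hasDerivAt
    have hFe : F = (fun z => z) * h := funext fun z => (hmul z).symm
    rw [hFe, hd.deriv]
    have := hne z hz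
    field_simp
  have hsol : ∀ w ∈ disk, ‖G w * h (G w)‖ < 1 := fun w hw => by
    rw [hmul, hinv hw]
    exact mem_ball_zero_iff.1 hw
  have hu : ∀ w ∈ disk, ‖G w * deriv h (G w) / h (G w)‖ ≤ A (r * q.re) := fun w hw => by
    refine (norm_mul_deriv_div_le hh hre (by linarith) (mem_ball_zero_iff.1 (hmaps hw))
      (hsol w hw)).trans ?_
    rw [h0, show 1 + r * q.re - 3 = r * q.re - 2 by ring]
    exact two_div_le_A (by linarith)
  have hu1 : ∀ w ∈ disk, 1 + G w * deriv h (G w) / h (G w) ≠ 0 := fun w hw he => by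
    have := hu w hw
    rw [← neg_eq_iff_add_eq_zero.2 he, norm_neg, norm_one] at this
    linarith
  have hderiv : ∀ w ∈ disk, HasDerivAt G (deriv F (G w))⁻¹ w := fun w hw => by
    refine hasDerivAt_rightInvOn isOpen_ball isOpen_ball hF.1 hmaps hinv ?_ hw ?_
    · intro z₁ hz₁ z₂ hz₂ hF₁ hF₁₂
      refine eq_of_mul_eq_mul hh hre (by linarith) (mem_ball_zero_iff.1 hz₁)
        (mem_ball_zero_iff.1 hz₂) ?_ ?_
      · rw [hmul]
        exact mem_ball_zero_iff.1 hF₁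
      · rwa [hmul, hmul]
    · rw [hFderiv _ (hmaps hw)]
      exact mul_ne_zero (hne _ (hmaps hw)) (hu1 w hw)
  have hzero : (0 : ℂ) ∈ disk := mem_ball_self one_pos
  have hG0 : G 0 = 0 := by
    have := hmul (G 0)
    rw [hinv hzero] at this
    exact (mul_eq_zero.1 this).resolve_right (hne _ (hmaps hzero))
  have hGne : ∀ w ∈ disk, w ≠ 0 → G w ≠ 0 := fun w hw hw0 hGw => by
    have := hinv hw
    rw [hGw, hF0] at this
    exact hw0 this.symm
  have hdG0 : deriv G 0 ≠ 0 := by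
    rw [(hderiv 0 hzero).deriv, hFderiv _ (hmaps hzero)]
    exact inv_ne_zero (mul_ne_zero (hne _ (hmaps hzero)) (hu1 0 hzero))
  refine ⟨fun w hw => (hderiv w hw).differentiableAt.differentiableWithinAt, hG0, hdG0, hGne,
    ⟨hA0, hA1⟩, fun w hw => ?_⟩
  have hratio : starRatio G w = 1 / (1 + G w * deriv h (G w) / h (G w)) := by
    rcases eq_or_ne w 0 with rfl | hw0
    · rw [starRatio_zero hdG0, hG0]
      simp
    · have hGw := hGne w hw hw0
      have hhG := hne _ (hmaps hw)
      rw [starRatio_of_ne hG0 hw0, (hderiv w hw).deriv, hFderiv _ (hmaps hw),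
        div_eq_div_iff hGw (hu1 w hw), mul_inv, mul_assoc, mul_assoc,
        inv_mul_cancel₀ (hu1 w hw), mul_one, one_mul, ← div_eq_mul_inv, div_eq_iff hhG, hmul,
        hinv hw]
  rw [hratio]
  exact norm_one_div_one_add_sub_le (hu w hw) hA1
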